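/- Let $(E,d)$ be a metric space with its Borel $\sigma$-field and let $P$ be a Borel probability measure on $E$ that is concentrated on a separable set, i.e. $P(E\setminus S)=0$ for some separable $S\subset E$ (automatic if $E$ is separable). Fix $\delta>0$ and write $B_{x,\delta}=\{y\in E: d(x,y)<\delta\}$. Let $\boldsymbol\nu_\delta$ be the measure on $[0,1]$ given by $$\int_0^1 f(u)\,\boldsymbol\nu_\delta(du)=\int_E \frac{f(P(B_{x,\delta}))}{P(B_{x,\delta})}\,P(dx)\qquad (f:[0,1]\to[0,\infty)\text{ measurable}),$$ and let $$\nu_\delta(\varepsilon)=\boldsymbol\nu_\delta([\varepsilon,1])=\int_{\{x:\,P(B_{x,\delta})\ge\varepsilon\}}\frac{P(dx)}{P(B_{x,\delta})},\qquad 0<\varepsilon\le 1 .$$ Let $X_1,X_2,\dots$ be i.i.d. $E$-valued random variables with distribution $P$. For integers $n,r\ge0$ and $x\in E$ put $\xi^{(\delta)}_n(x)=|\{1\le i\le n: d(x,X_i)<\delta\}|$ and $$M^{(\delta)}_{n,r}=\int_E \mathbf 1\{\xi^{(\delta)}_n(x)=r\}\,P(dx).$$ Let $(n_t)_{t\ge0}$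 be a non-homogeneous Poisson process, independent of $(X_i)_{i\ge1}$, with locally integrable intensity function $\lambda:[0,\infty)\to[0,\infty)$; let $\Lambda_t=\int_0^t\lambda(u)\,du$, assume $\Lambda_t\to+\infty$ as $t\to+\infty$, and put $M^{(\delta)}_r(t)=M^{(\delta)}_{n_t,r}$. Suppose that for some $\alpha\in[0,1]$ and some function $\ell$ that is slowly varying at $+\infty$ (that is, $\ell(cx)/\ell(x)\to1$ as $x\to+\infty$ for every $c>0$) we have $\nu_\delta(\varepsilon)=\varepsilon^{-\alpha}\ell(1/\varepsilon)$ for all $0<\varepsilon\le1$. Then, for every integer $r\ge0$, the random variables $M^{(\delta)}_r(t)$ are integrable and, as $t\to+\infty$, $$\mathbb E M^{(\delta)}_r(t)\sim\frac{\alpha\,\Gamma(1+r-\alpha)}{r!}\,\Lambda_t^{\alpha-1}\,\ell(\Lambda_t),$$ where $g\sim h$ means $g/h\to1$. In the two cases where the constant on the right is $0$ or $+\infty$, this is to be read as follows: if $\alpha=0$, then $\mathbb E M^{(\delta)}_r(t)/(\Lambda_t^{-1}\ell(\Lambda_t))\to0$; if $\alpha=1$ and $r=0$, then $\mathbb E M^{(\delta)}_0(t)/\ell(\Lambda_t)\to+\infty$.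 -/

import Mathlib

open MeasureTheory ProbabilityTheory Filter Topology
open scoped NNReal ENNReal

noncomputable section

namespace Occupancy

/-- `f` is regularly varying at `+∞` with exponent `ρ`:
`f (c x) / f x → c ^ ρ` as `x → +∞`, for every `c > 0`. -/
def RegularlyVaryingAtTop (f : ℝ → ℝ) (ρ : ℝ) : Prop :=
  ∀ c : ℝ, 0 < c → Tendsto (fun x => f (c * x) / f x) atTop (𝓝 (c ^ ρ))

/-- Slowly varying at `+∞`: regularly varying with exponent `0`. -/
def SlowlyVaryingAtTop (f : ℝ → ℝ) : Prop := RegularlyVaryingAtTop f 0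

section MetricSpace

variable {E : Type*} [MetricSpace E] [MeasurableSpace E]

/-- The measure `𝛎_δ` on `[0, 1]` (seen as a measure on `ℝ`): the image under `x ↦ P (B_{x,δ})`
of the measure with density `x ↦ 1 / P (B_{x,δ})` with respect to `P`. -/
def ballCountingMeasure (P : Measure E) (δ : ℝ) : Measure ℝ :=
  (P.withDensity fun x => (P (Metric.ball x δ))⁻¹).map fun x => P.real (Metric.ball x δ)

/-- The generalized counting function `ν_δ (ε) = 𝛎_δ ([ε, 1])`. For `0 < ε ≤ 1` it is finite
(at most `1 / ε`). -/
def ballCountingFun (P : Measure E) (δ ε : ℝ) : ℝ :=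
  (ballCountingMeasure P δ).real (Set.Icc ε 1)

/-- `ξ_n^{(δ)}(x)`: the number of `i < n` such that `x` lies in the open ball of
radius `δ` around the sample point `s i`. -/
def ballCount (s : ℕ → E) (δ : ℝ) (n : ℕ) (x : E) : ℕ :=
  ∑ i ∈ Finset.range n, (Metric.ball (s i) δ).indicator (fun _ => 1) x

/-- The occupancy probability `M_{n,r}^{(δ)} = ∫ 𝟏{ξ_n^{(δ)}(x) = r} P(dx)` of the sample
`s 0, …, s (n - 1)`. -/
def occupancyProb (P : Measure E) (δ : ℝ) (s : ℕ → E) (n r : ℕ) : ℝ :=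
  ∫ x, {y | ballCount s δ n y = r}.indicator (fun _ => (1 : ℝ)) x ∂P

theorem measurable_measure_ball [BorelSpace E] (P : Measure E) [IsProbabilityMeasure P] (δ : ℝ) :
    Measurable fun x => P (Metric.ball x δ) := by
  apply LowerSemicontinuous.measurable
  intro x c hc
  -- the smaller concentric balls exhaust the ball
  have hU : Metric.ball x δ = ⋃ n : ℕ, Metric.ball x (δ - 1 / ((n : ℝ) + 1)) := by
    ext y
    simp only [Metric.mem_ball, Set.mem_iUnion]
    constructor
    · intro h
      obtain ⟨n, hn⟩ := exists_nat_one_div_lt (sub_pos.2 h)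
      exact ⟨n, by linarith⟩
    · rintro ⟨n, hn⟩
      have : 0 < 1 / ((n : ℝ) + 1) := by positivity
      linarith
  have hmono : Monotone fun n : ℕ => Metric.ball x (δ - 1 / ((n : ℝ) + 1)) := by
    intro m n hmn
    apply Metric.ball_subset_ball
    have : 1 / ((n : ℝ) + 1) ≤ 1 / ((m : ℝ) + 1) := by gcongr
    linarith
  have hsup : c < ⨆ n : ℕ, P (Metric.ball x (δ - 1 / ((n : ℝ) + 1))) := by
    rw [← hmono.measure_iUnion, ← hU]; exact hc
  obtain ⟨n, hn⟩ := lt_iSup_iff.1 hsup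
  have hpos : 0 < 1 / ((n : ℝ) + 1) := by positivity
  filter_upwards [Metric.ball_mem_nhds x hpos] with y hy
  refine hn.trans_le (measure_mono (Metric.ball_subset_ball' ?_))
  rw [Metric.mem_ball, dist_comm] at hy
  linarith

/-- The identity by which `𝛎_δ` is characterized. -/
theorem lintegral_ballCountingMeasure [BorelSpace E] (P : Measure E) [IsProbabilityMeasure P]
    (δ : ℝ) (f : ℝ → ℝ≥0∞) (hf : Measurable f) :
    ∫⁻ u, f u ∂(ballCountingMeasure P δ) =
      ∫⁻ x, (P (Metric.ball x δ))⁻¹ * f (P.real (Metric.ball x δ)) ∂P := by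
  have hm := measurable_measure_ball P δ
  have hr : Measurable fun x => P.real (Metric.ball x δ) := hm.ennreal_toReal
  rw [ballCountingMeasure, lintegral_map hf hr]
  exact lintegral_withDensity_eq_lintegral_mul P hm.inv (hf.comp hr)

end MetricSpace

/-- The cumulative intensity `Λ_t = ∫_0^t λ(u) du`. -/
def cumulativeIntensity (lam : ℝ → ℝ) (t : ℝ≥0) : ℝ :=
  ∫ u in (0 : ℝ)..t, lam u

/-- `N` is a (non-homogeneous) Poisson process with intensity function `lam` on `[0, ∞)`:
`N 0 = 0`, the paths are nondecreasing and right-continuous, the increments are independent, and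
`N t - N s` has the Poisson distribution with mean `∫_s^t lam`. -/
structure IsPoissonProcess {Ω : Type*} [MeasurableSpace Ω] (N : ℝ≥0 → Ω → ℕ) (lam : ℝ → ℝ)
    (μ : Measure Ω) : Prop where
  intensity_nonneg : ∀ u : ℝ, 0 ≤ u → 0 ≤ lam u
  intensity_integrable : ∀ t : ℝ≥0, IntervalIntegrable lam volume 0 t
  measurable : ∀ t, Measurable (N t)
  start : ∀ᵐ ω ∂μ, N 0 ω = 0
  monotone : ∀ᵐ ω ∂μ, Monotone fun t => N t ω
  right_continuous : ∀ᵐ ω ∂μ, ∀ t, ContinuousWithinAt (fun s => N s ω) (Set.Ici t) t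
  indep_increments : HasIndepIncrements N μ
  increment_law : ∀ s t : ℝ≥0, s ≤ t →
    μ.map (fun ω => N t ω - N s ω) = poissonMeasure (∫ u in (s : ℝ)..t, lam u).toNNReal

end Occupancy

end

/-!
Write `p(x) = P (B_{x,δ})` and `ν = 𝛎_δ`.

*Probability.* By separability of the support, the relation `d(x, y) < δ` agrees, for `P`-almost
every `x`, with a set measurable for the product `σ`-algebra, so Fubini's theorem applies to the
occupancy probability. For fixed `x` the number of sample points in `B_{x,δ}` is a binomial count
with a Poisson number of trials, hence Poisson with mean `Λ_t p(x)`. Therefore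
`𝔼 M_r(t) = ∫ e^{-Λ p} (Λ p)^r / r! dP = (Λ r!)⁻¹ ∫ (Λ u)^{r+1} e^{-Λ u} ν(du)` with `Λ = Λ_t`
(`integrable_occupancyProb_and_integral_eq`, `integral_ballCountingMeasure_mul`).

*Analysis.* Put `H(x) = ν([1/x, ∞))`. It is nondecreasing, equals `x^α ℓ(x)` for `x ≥ 1`, and so
is regularly varying with exponent `α`. The layer cake formula applied to the two terms
of the derivative `a s^{a-1} e^{-s} - s^a e^{-s}` of `s^a e^{-s}` gives
`∫ (x u)^a e^{-x u} ν(du) = ∫_0^∞ (a s^{a-1} - s^a) e^{-s} H(x/s) ds`.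
After division by `H(x)` the integrand converges pointwise, since `H(x/s)/H(x) → s^{-α}`, and it is
dominated thanks to a Potter bound, which follows from monotonicity. So for `a > α` the
limit is `a Γ(a-α) - Γ(a+1-α) = α Γ(a-α)` (`tendsto_integral_rpow_mul_exp`). This covers every case
except `a = α = 1`. There `v ≥ v^{1+η} - v^2` for `v ≥ 0` and `0 < η < 1`; applying the theorem
with the exponents `1 + η` and `2`, the lower limit is at least `Γ(η) - Γ(1)`, which is
unbounded as `η → 0` (`tendsto_integral_mul_exp_atTop`).
-/

namespace Occupancy

/-! ### Regularly varying monotone functions -/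

theorem RegularlyVaryingAtTop.eventually_pos {H : ℝ → ℝ} {ρ : ℝ}
    (h : RegularlyVaryingAtTop H ρ) (h0 : ∀ x, 0 ≤ H x) : ∀ᶠ x in atTop, 0 < H x := by
  have h1 := h 1 one_pos
  simp only [one_mul, Real.one_rpow] at h1
  filter_upwards [h1.eventually_ne one_ne_zero] with x hx
  refine (h0 x).lt_of_ne' fun h => hx (by simp [h])

/-- A one-sided Potter bound. For a nondecreasing function no uniform convergence theorem is needed:
iterating `H (2 x) ≤ 2 ^ β * H x` controls `H` along `2 ^ k * x`, and monotonicity fills the gaps. -/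
theorem RegularlyVaryingAtTop.potter_bound {H : ℝ → ℝ} {α β : ℝ}
    (h : RegularlyVaryingAtTop H α) (h0 : ∀ x, 0 ≤ H x) (hmono : MonotoneOn H (Set.Ioi 0))
    (hα : 0 ≤ α) (hβ : α < β) :
    ∀ᶠ x in atTop, ∀ y : ℝ, 1 ≤ y → H (y * x) ≤ 2 ^ β * y ^ β * H x := by
  have hβ0 : 0 < β := hα.trans_lt hβ
  have hlt : (2 : ℝ) ^ α < 2 ^ β := Real.rpow_lt_rpow_of_exponent_lt (by norm_num) hβ
  have hev : ∀ᶠ x in atTop, H (2 * x) ≤ 2 ^ β * H x := by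
    filter_upwards [(h 2 two_pos).eventually_lt_const hlt, h.eventually_pos h0] with x hx hp
    exact ((div_lt_iff₀ hp).1 hx).le
  obtain ⟨x₀, hx₀⟩ := eventually_atTop.1 hev
  filter_upwards [eventually_ge_atTop x₀, eventually_gt_atTop 0] with x hx hxpos y hy
  have hiter : ∀ k : ℕ, H (2 ^ k * x) ≤ (2 ^ β) ^ k * H x := by
    intro k
    induction k with
    | zero => simp
    | succ k ih =>
      have hk : x ≤ 2 ^ k * x := le_mul_of_one_le_left hxpos.le (one_le_pow₀ (by norm_num))
      calc H (2 ^ (k + 1) * x) = H (2 * (2 ^ k * x)) := by ring_nf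
        _ ≤ 2 ^ β * H (2 ^ k * x) := hx₀ _ (hx.trans hk)
        _ ≤ 2 ^ β * ((2 ^ β) ^ k * H x) := by gcongr
        _ = (2 ^ β) ^ (k + 1) * H x := by ring
  obtain ⟨k, hk1, hk2⟩ := exists_nat_pow_near hy (one_lt_two : (1 : ℝ) < 2)
  calc H (y * x) ≤ H (2 ^ (k + 1) * x) :=
        hmono (Set.mem_Ioi.2 (by positivity)) (Set.mem_Ioi.2 (by positivity)) (by gcongr)
    _ ≤ (2 ^ β) ^ (k + 1) * H x := hiter _
    _ = 2 ^ β * ((2 : ℝ) ^ k) ^ β * H x := by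
        rw [pow_succ, mul_comm ((2 ^ β : ℝ) ^ k), ← Real.rpow_natCast, ← Real.rpow_natCast,
          ← Real.rpow_mul zero_le_two, ← Real.rpow_mul zero_le_two, mul_comm β]
    _ ≤ 2 ^ β * y ^ β * H x := by
        have := h0 x
        gcongr

theorem integrableOn_rpow_mul_exp_neg {b : ℝ} (hb : 0 < b + 1) :
    IntegrableOn (fun s : ℝ => s ^ b * Real.exp (-s)) (Set.Ioi 0) := by
  have := Real.GammaIntegral_convergent hb
  simpa [mul_comm] using this

theorem integral_rpow_mul_exp_neg {b : ℝ} (hb : 0 < b + 1) :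
    ∫ s in Set.Ioi (0 : ℝ), s ^ b * Real.exp (-s) = Real.Gamma (b + 1) := by
  rw [Real.Gamma_eq_integral hb]
  simp [mul_comm]

/-- The pointwise limits `H (x / s) / H x → s ^ (-α)` may be integrated against the Gamma density:
the integrand is dominated by the Potter bound for `s ≤ 1` and by monotonicity for `s ≥ 1`. -/
theorem RegularlyVaryingAtTop.tendsto_integral_gamma {H : ℝ → ℝ} {α b : ℝ}
    (h : RegularlyVaryingAtTop H α) (h0 : ∀ x, 0 ≤ H x) (hmono : MonotoneOn H (Set.Ioi 0))
    (hα : 0 ≤ α) (hb : α < b + 1) :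
    (∀ᶠ x in atTop,
      IntegrableOn (fun s => s ^ b * Real.exp (-s) * H (x / s)) (Set.Ioi 0)) ∧
    Tendsto (fun x => (∫ s in Set.Ioi (0 : ℝ), s ^ b * Real.exp (-s) * H (x / s)) / H x) atTop
      (𝓝 (Real.Gamma (b + 1 - α))) := by
  -- any Potter exponent strictly between `α` and `b + 1` keeps the bound integrable at `0`
  set β := (α + (b + 1)) / 2 with hβ
  have hαβ : α < β := by linarith
  have hβb : β < b + 1 := by linarith
  set bound : ℝ → ℝ := fun s =>
    2 ^ β * (s ^ (b - β) * Real.exp (-s)) + 2 ^ β * (s ^ b * Real.exp (-s)) with hbound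
  have hbint : IntegrableOn bound (Set.Ioi 0) :=
    ((integrableOn_rpow_mul_exp_neg (by linarith)).const_mul _).add
      ((integrableOn_rpow_mul_exp_neg (by linarith)).const_mul _)
  have hmeas : ∀ x : ℝ, 0 < x → AEStronglyMeasurable
      (fun s => s ^ b * Real.exp (-s) * H (x / s)) (volume.restrict (Set.Ioi 0)) := by
    intro x hx
    refine AEStronglyMeasurable.mul (by fun_prop) ?_
    refine (aemeasurable_restrict_of_antitoneOn measurableSet_Ioi ?_).aestronglyMeasurable
    intro s hs s' hs' hss
    rw [Set.mem_Ioi] at hs hs'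
    exact hmono (Set.mem_Ioi.2 (by positivity)) (Set.mem_Ioi.2 (by positivity)) (by gcongr)
  have hle : ∀ᶠ x in atTop, ∀ s ∈ Set.Ioi (0 : ℝ),
      ‖s ^ b * Real.exp (-s) * H (x / s)‖ ≤ bound s * H x := by
    filter_upwards [h.potter_bound h0 hmono hα hαβ, eventually_gt_atTop 0] with x hx hxpos s hs
    rw [Set.mem_Ioi] at hs
    have hHx := h0 x
    have hH : H (x / s) ≤ (2 ^ β * s ^ (-β) + 2 ^ β) * H x := by
      rcases le_total s 1 with hs1 | hs1
      · have := hx s⁻¹ ((one_le_inv₀ hs).2 hs1)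
        rw [Real.inv_rpow hs.le, ← Real.rpow_neg hs.le, inv_mul_eq_div] at this
        refine this.trans ?_
        gcongr
        simp only [le_add_iff_nonneg_right]; positivity
      · have h1 : H (x / s) ≤ H x :=
          hmono (Set.mem_Ioi.2 (by positivity)) hxpos (div_le_self hxpos.le hs1)
        have h2 : (1 : ℝ) ≤ 2 ^ β := Real.one_le_rpow (by norm_num) (by linarith)
        have h3 : 0 ≤ (2 : ℝ) ^ β * s ^ (-β) := by positivity
        nlinarith
    rw [Real.norm_of_nonneg (mul_nonneg (by positivity) (h0 _))]
    calc s ^ b * Real.exp (-s) * H (x / s)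
        ≤ s ^ b * Real.exp (-s) * ((2 ^ β * s ^ (-β) + 2 ^ β) * H x) := by gcongr
      _ = bound s * H x := by
        simp only [hbound]
        rw [sub_eq_add_neg, Real.rpow_add hs]; ring
  refine ⟨?_, ?_⟩
  · filter_upwards [hle, eventually_gt_atTop 0] with x hx hxpos
    refine (hbint.mul_const (H x)).mono' (hmeas x hxpos) ?_
    exact (ae_restrict_mem measurableSet_Ioi).mono hx
  · rw [show b + 1 - α = (b - α) + 1 by ring, ← integral_rpow_mul_exp_neg (by linarith)]
    simp_rw [← integral_div]
    refine tendsto_integral_filter_of_dominated_convergence bound ?_ ?_ hbint ?_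
    · filter_upwards [eventually_gt_atTop 0] with x hx
      simp_rw [div_eq_mul_inv _ (H x)]
      exact (hmeas x hx).mul_const _
    · filter_upwards [hle, h.eventually_pos h0] with x hx hp
      refine (ae_restrict_mem measurableSet_Ioi).mono fun s hs => ?_
      rw [norm_div, Real.norm_of_nonneg hp.le, div_le_iff₀ hp]
      exact hx s hs
    · refine (ae_restrict_mem measurableSet_Ioi).mono fun s hs => ?_
      rw [Set.mem_Ioi] at hs
      have := (h s⁻¹ (inv_pos.2 hs)).const_mul (s ^ b * Real.exp (-s))
      rw [Real.inv_rpow hs.le, ← Real.rpow_neg hs.le] at this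
      rw [sub_eq_add_neg, Real.rpow_add hs]
      refine (this.congr fun x => ?_).trans (by rw [mul_right_comm])
      rw [inv_mul_eq_div, mul_div_assoc]

/-! ### The Abelian theorem for a measure with regularly varying tail -/

/-- The layer cake formula in Bochner form, for a measure on `[0, ∞)` that may have infinite mass
near `0`: the primitive of `g` at `x u` is integrated in terms of the tail of `ν`. -/
theorem integral_primitive_comp_mul {ν : Measure ℝ} (hν0 : ∀ᵐ u ∂ν, 0 ≤ u)
    (hνfin : ∀ ε : ℝ, 0 < ε → ν (Set.Ici ε) ≠ ∞) {g : ℝ → ℝ} (hg : Integrable g)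
    (hg0 : ∀ s, 0 ≤ g s) {x : ℝ} (hx : 0 < x)
    (hint : IntegrableOn (fun s => g s * ν.real (Set.Ici (s / x))) (Set.Ioi 0)) :
    Integrable (fun u => ∫ s in (0 : ℝ)..x * u, g s) ν ∧
    ∫ u, (∫ s in (0 : ℝ)..x * u, g s) ∂ν =
      ∫ s in Set.Ioi (0 : ℝ), g s * ν.real (Set.Ici (s / x)) := by
  have hcont : Continuous fun u => ∫ s in (0 : ℝ)..x * u, g s :=
    (intervalIntegral.continuous_primitive (fun a b => hg.intervalIntegrable) 0).comp
      (continuous_const_mul x)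
  have hnn : ∀ᵐ u ∂ν, 0 ≤ ∫ s in (0 : ℝ)..x * u, g s := by
    filter_upwards [hν0] with u hu
    exact intervalIntegral.integral_nonneg (by positivity) fun s _ => hg0 s
  have hcake : ∫⁻ u, ENNReal.ofReal (∫ s in (0 : ℝ)..x * u, g s) ∂ν =
      ∫⁻ s in Set.Ioi (0 : ℝ), ENNReal.ofReal (g s * ν.real (Set.Ici (s / x))) := by
    rw [lintegral_comp_eq_lintegral_meas_le_mul ν (f := fun u => x * u)
      (hν0.mono fun u hu => mul_nonneg hx.le hu) (by fun_prop)
      (fun t _ => hg.intervalIntegrable) (ae_of_all _ hg0)]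
    refine setLIntegral_congr_fun measurableSet_Ioi fun s hs => ?_
    have hset : {u : ℝ | s ≤ x * u} = Set.Ici (s / x) := by
      ext u; simp [div_le_iff₀' hx]
    simp only [hset]
    rw [ENNReal.ofReal_mul (hg0 s), mul_comm, ofReal_measureReal (hνfin _ (div_pos hs hx))]
  have hnn' : 0 ≤ᵐ[volume.restrict (Set.Ioi 0)] fun s => g s * ν.real (Set.Ici (s / x)) :=
    ae_of_all _ fun s => mul_nonneg (hg0 s) measureReal_nonneg
  have hof := ofReal_integral_eq_lintegral_ofReal hint hnn'
  refine ⟨⟨hcont.aestronglyMeasurable, ?_⟩, ?_⟩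
  · rw [hasFiniteIntegral_iff_ofReal hnn, hcake, ← hof]
    exact ENNReal.ofReal_lt_top
  · rw [integral_eq_lintegral_of_nonneg_ae hnn hcont.aestronglyMeasurable, hcake, ← hof,
      ENNReal.toReal_ofReal (integral_nonneg_of_ae hnn')]

/-- `v ^ a * exp (-v)` as the difference of the primitives of the two terms of its derivative. The
indicators make both terms integrable on the whole line. -/
theorem intervalIntegral_gamma_density {a v : ℝ} (ha : 0 < a) (hv : 0 ≤ v) :
    (∫ s in (0 : ℝ)..v,
        (Set.Ioi (0 : ℝ)).indicator (fun s => a * (s ^ (a - 1) * Real.exp (-s))) s) -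
      (∫ s in (0 : ℝ)..v, (Set.Ioi (0 : ℝ)).indicator (fun s => s ^ a * Real.exp (-s)) s) =
    v ^ a * Real.exp (-v) := by
  have h1 : Integrable ((Set.Ioi (0 : ℝ)).indicator
      fun s => a * (s ^ (a - 1) * Real.exp (-s))) := by
    rw [integrable_indicator_iff measurableSet_Ioi]
    exact (integrableOn_rpow_mul_exp_neg (by linarith)).const_mul a
  have h2 : Integrable ((Set.Ioi (0 : ℝ)).indicator fun s => s ^ a * Real.exp (-s)) := by
    rw [integrable_indicator_iff measurableSet_Ioi]
    exact integrableOn_rpow_mul_exp_neg (by linarith)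
  rw [← intervalIntegral.integral_sub h1.intervalIntegrable h2.intervalIntegrable]
  rw [intervalIntegral.integral_eq_sub_of_hasDerivAt_of_le hv
    (f := fun s => s ^ a * Real.exp (-s)) ?_ ?_
    (h1.intervalIntegrable.sub h2.intervalIntegrable)]
  · simp [Real.zero_rpow ha.ne']
  · exact ((Real.continuous_rpow_const ha.le).mul (by fun_prop)).continuousOn
  · intro s hs
    have hs0 : s ∈ Set.Ioi (0 : ℝ) := hs.1
    rw [Set.indicator_of_mem hs0, Set.indicator_of_mem hs0]
    have := (Real.hasDerivAt_rpow_const (p := a) (Or.inl (ne_of_gt hs.1))).mul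
      ((hasDerivAt_neg s).exp)
    convert! this using 1
    ring

/-- Abelian theorem: if the tail `x ↦ ν [1/x, ∞)` is regularly varying with exponent `α ≥ 0`, then
`∫ (x u) ^ a * exp (-x u) ν(du)` is asymptotically `α Γ(a - α) ν [1/x, ∞)` for every `a > α`. -/
theorem tendsto_integral_rpow_mul_exp {ν : Measure ℝ} (hν0 : ∀ᵐ u ∂ν, 0 ≤ u)
    (hνfin : ∀ ε : ℝ, 0 < ε → ν (Set.Ici ε) ≠ ∞) {α a : ℝ} (hα : 0 ≤ α) (ha : α < a)
    (hRV : RegularlyVaryingAtTop (fun x => ν.real (Set.Ici (1 / x))) α) :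
    (∀ᶠ x in atTop, Integrable (fun u => (x * u) ^ a * Real.exp (-(x * u))) ν) ∧
    Tendsto (fun x => (∫ u, (x * u) ^ a * Real.exp (-(x * u)) ∂ν) / ν.real (Set.Ici (1 / x)))
      atTop (𝓝 (α * Real.Gamma (a - α))) := by
  have ha0 : 0 < a := hα.trans_lt ha
  have hmono : MonotoneOn (fun x => ν.real (Set.Ici (1 / x))) (Set.Ioi 0) := by
    intro x hx y hy hxy
    rw [Set.mem_Ioi] at hx hy
    exact measureReal_mono (Set.Ici_subset_Ici.2 (by gcongr)) (hνfin _ (by positivity))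
  have h0 : ∀ x : ℝ, 0 ≤ ν.real (Set.Ici (1 / x)) := fun x => measureReal_nonneg
  obtain ⟨hi1, ht1⟩ := hRV.tendsto_integral_gamma (b := a - 1) h0 hmono hα (by linarith)
  obtain ⟨hi2, ht2⟩ := hRV.tendsto_integral_gamma (b := a) h0 hmono hα (by linarith)
  simp only [one_div_div] at hi1 ht1 hi2 ht2
  set g₁ : ℝ → ℝ := (Set.Ioi (0 : ℝ)).indicator fun s => a * (s ^ (a - 1) * Real.exp (-s)) with hg₁
  set g₂ : ℝ → ℝ := (Set.Ioi (0 : ℝ)).indicator fun s => s ^ a * Real.exp (-s) with hg₂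
  have hg1 : Integrable g₁ := by
    rw [hg₁, integrable_indicator_iff measurableSet_Ioi]
    exact (integrableOn_rpow_mul_exp_neg (by linarith)).const_mul a
  have hg2 : Integrable g₂ := by
    rw [hg₂, integrable_indicator_iff measurableSet_Ioi]
    exact integrableOn_rpow_mul_exp_neg (by linarith)
  have hg1n : ∀ s, 0 ≤ g₁ s := Set.indicator_nonneg fun s (hs : 0 < s) => by positivity
  have hg2n : ∀ s, 0 ≤ g₂ s := Set.indicator_nonneg fun s (hs : 0 < s) => by positivity
  have he1 : ∀ x : ℝ, Set.EqOn (fun s => g₁ s * ν.real (Set.Ici (s / x)))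
      (fun s => a * (s ^ (a - 1) * Real.exp (-s) * ν.real (Set.Ici (s / x)))) (Set.Ioi 0) := by
    intro x s hs
    simp only [hg₁, Set.indicator_of_mem hs]; ring
  have he2 : ∀ x : ℝ, Set.EqOn (fun s => g₂ s * ν.real (Set.Ici (s / x)))
      (fun s => s ^ a * Real.exp (-s) * ν.real (Set.Ici (s / x))) (Set.Ioi 0) := by
    intro x s hs
    simp only [hg₂, Set.indicator_of_mem hs]
  have key : ∀ᶠ x in atTop, Integrable (fun u => (x * u) ^ a * Real.exp (-(x * u))) ν ∧
      ∫ u, (x * u) ^ a * Real.exp (-(x * u)) ∂ν =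
        a * (∫ s in Set.Ioi (0 : ℝ), s ^ (a - 1) * Real.exp (-s) * ν.real (Set.Ici (s / x))) -
        ∫ s in Set.Ioi (0 : ℝ), s ^ a * Real.exp (-s) * ν.real (Set.Ici (s / x)) := by
    filter_upwards [hi1, hi2, eventually_gt_atTop 0] with x hx1 hx2 hx
    obtain ⟨hI1, hE1⟩ := integral_primitive_comp_mul hν0 hνfin hg1 hg1n hx
      ((integrableOn_congr_fun (he1 x) measurableSet_Ioi).2 (hx1.const_mul a))
    obtain ⟨hI2, hE2⟩ := integral_primitive_comp_mul hν0 hνfin hg2 hg2n hx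
      ((integrableOn_congr_fun (he2 x) measurableSet_Ioi).2 hx2)
    have hae : (fun u => (∫ s in (0 : ℝ)..x * u, g₁ s) - ∫ s in (0 : ℝ)..x * u, g₂ s) =ᵐ[ν]
        fun u => (x * u) ^ a * Real.exp (-(x * u)) := by
      filter_upwards [hν0] with u hu
      exact intervalIntegral_gamma_density ha0 (by positivity)
    refine ⟨(hI1.sub hI2).congr hae, ?_⟩
    rw [← integral_congr_ae hae, integral_sub hI1 hI2, hE1, hE2,
      setIntegral_congr_fun measurableSet_Ioi (he1 x),
      setIntegral_congr_fun measurableSet_Ioi (he2 x), integral_const_mul]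
  refine ⟨key.mono fun x hx => hx.1, ?_⟩
  have hlim := (ht1.const_mul a).sub ht2
  have hconst : a * Real.Gamma (a - 1 + 1 - α) - Real.Gamma (a + 1 - α) =
      α * Real.Gamma (a - α) := by
    rw [show a + 1 - α = (a - α) + 1 by ring, Real.Gamma_add_one (by linarith),
      show a - 1 + 1 - α = a - α by ring]
    ring
  rw [hconst] at hlim
  refine hlim.congr' ?_
  filter_upwards [key] with x hx
  rw [hx.2]; ring

theorem tendsto_Gamma_nhdsGT_zero : Tendsto Real.Gamma (𝓝[>] 0) atTop := by
  have h1 : Tendsto (fun s : ℝ => Real.Gamma (s + 1)) (𝓝[>] 0) (𝓝 1) := by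
    have hc : ContinuousAt (fun s : ℝ => Real.Gamma (s + 1)) 0 := by
      refine ContinuousAt.comp (g := Real.Gamma) ?_ (by fun_prop)
      refine (Real.differentiableAt_Gamma fun m => ?_).continuousAt
      have : (0 : ℝ) ≤ m := m.cast_nonneg
      linarith
    have := hc.tendsto
    simp only [zero_add, Real.Gamma_one] at this
    exact this.mono_left nhdsWithin_le_nhds
  refine (h1.pos_mul_atTop one_pos tendsto_inv_nhdsGT_zero).congr' ?_
  filter_upwards [self_mem_nhdsWithin] with s hs
  rw [Set.mem_Ioi] at hs
  rw [Real.Gamma_add_one hs.ne']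
  field_simp

/-- The borderline case `a = α = 1` of the Abelian theorem, where the constant is `Γ(0) = ∞`. It
follows from the exponents `1 + η` and `2`, as `v ^ (1 + η) ≤ v + v ^ 2` for `v ≥ 0`. -/
theorem tendsto_integral_mul_exp_atTop {ν : Measure ℝ} (hν0 : ∀ᵐ u ∂ν, 0 ≤ u)
    (hνfin : ∀ ε : ℝ, 0 < ε → ν (Set.Ici ε) ≠ ∞) (hνint : Integrable (fun u => u) ν)
    (hRV : RegularlyVaryingAtTop (fun x => ν.real (Set.Ici (1 / x))) 1) :
    Tendsto (fun x => (∫ u, x * u * Real.exp (-(x * u)) ∂ν) / ν.real (Set.Ici (1 / x)))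
      atTop atTop := by
  rw [tendsto_atTop]
  intro C
  obtain ⟨η, hηC, hη0, hη1⟩ := ((tendsto_Gamma_nhdsGT_zero.eventually_gt_atTop (C + 1)).and
    (Ioo_mem_nhdsGT (one_pos : (0 : ℝ) < 1))).exists
  obtain ⟨hi1, ht1⟩ := tendsto_integral_rpow_mul_exp (a := 1 + η) hν0 hνfin zero_le_one
    (by linarith) hRV
  obtain ⟨hi2, ht2⟩ := tendsto_integral_rpow_mul_exp (a := 2) hν0 hνfin zero_le_one
    (by norm_num) hRV
  have hlim := ht1.sub ht2
  rw [show (1 : ℝ) + η - 1 = η by ring, show (2 : ℝ) - 1 = 1 by norm_num, Real.Gamma_one] at hlim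
  filter_upwards [hlim.eventually_const_lt (u := C) (by linarith), hi1, hi2,
    eventually_gt_atTop 0] with x hxC hx1 hx2 hx
  refine hxC.le.trans ?_
  rw [← sub_div]
  refine div_le_div_of_nonneg_right ?_ measureReal_nonneg
  have hint : Integrable (fun u => x * u * Real.exp (-(x * u))) ν := by
    refine (hνint.const_mul x).mono (by fun_prop) ?_
    filter_upwards [hν0] with u hu
    rw [norm_mul, Real.norm_of_nonneg (Real.exp_pos _).le]
    exact mul_le_of_le_one_right (norm_nonneg _) (Real.exp_le_one_iff.2 (by simp; positivity))
  rw [← integral_sub hx1 hx2]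
  refine integral_mono_ae (hx1.sub hx2) hint ?_
  filter_upwards [hν0] with u hu
  have hv : 0 ≤ x * u := by positivity
  -- the intermediate power is at most `x * u` or `(x * u) ^ 2` according to whether `x * u ≤ 1`
  have hpow : (x * u) ^ (1 + η) ≤ x * u + (x * u) ^ (2 : ℝ) := by
    rcases le_total (x * u) 1 with h | h
    · have h1 := Real.rpow_le_rpow_of_exponent_ge' hv h zero_le_one (by linarith : 1 ≤ 1 + η)
      rw [Real.rpow_one] at h1
      have : 0 ≤ (x * u) ^ (2 : ℝ) := by positivity
      linarith
    · have := Real.rpow_le_rpow_of_exponent_le h (by linarith : 1 + η ≤ 2)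
      linarith
  have := Real.exp_pos (-(x * u))
  nlinarith

/-! ### Counting sample points -/

section Counting

variable {E Ω : Type*} [MeasurableSpace E] [MeasurableSpace Ω]

theorem measurable_sum_indicator {B : Set E} (hB : MeasurableSet B) (n : ℕ) :
    Measurable fun s : ℕ → E => ∑ i ∈ Finset.range n, B.indicator (fun _ => (1 : ℕ)) (s i) := by
  refine Finset.measurable_sum _ fun i _ => ?_
  exact (measurable_const.indicator hB).comp (measurable_pi_apply i)

/-- The number of the first `n` sample points in `B` has the binomial distribution. The case `k > n`
is covered, as the binomial coefficient vanishes. -/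
theorem measureReal_sum_indicator_eq {P : Measure E} {μ : Measure Ω} [IsProbabilityMeasure μ]
    {X : ℕ → Ω → E} (hXm : ∀ i, Measurable (X i)) (hXlaw : ∀ i, μ.map (X i) = P)
    (hXind : iIndepFun X μ) {B : Set E} (hB : MeasurableSet B) (n k : ℕ) :
    μ.real {ω | ∑ i ∈ Finset.range n, B.indicator (fun _ => (1 : ℕ)) (X i ω) = k} =
      n.choose k * P.real B ^ k * (1 - P.real B) ^ (n - k) := by
  set Y : ℕ → Ω → ℕ := fun i ω => B.indicator (fun _ => (1 : ℕ)) (X i ω) with hY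
  have hYm : ∀ i, Measurable (Y i) := fun i => (measurable_const.indicator hB).comp (hXm i)
  have hYind : iIndepFun Y μ := hXind.comp _ fun _ => measurable_const.indicator hB
  have h1 : ∀ i, μ.real (Y i ⁻¹' {1}) = P.real B := by
    intro i
    rw [← hXlaw i, map_measureReal_apply (hXm i) hB]
    congr 1
    ext ω
    by_cases h : X i ω ∈ B <;> simp [hY, h]
  have h0 : ∀ i, μ.real (Y i ⁻¹' {0}) = 1 - P.real B := by
    intro i
    rw [← h1 i, ← probReal_compl_eq_one_sub (hYm i (measurableSet_singleton 1))]
    congr 1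
    ext ω
    by_cases h : X i ω ∈ B <;> simp [hY, h]
  have hS : ∀ n, Measurable (∑ i ∈ Finset.range n, Y i) := fun n => by fun_prop
  have hind : ∀ n j l, μ.real ((∑ i ∈ Finset.range n, Y i) ⁻¹' {j} ∩ Y n ⁻¹' {l}) =
      μ.real ((∑ i ∈ Finset.range n, Y i) ⁻¹' {j}) * μ.real (Y n ⁻¹' {l}) := by
    intro n j l
    have := (hYind.indepFun_sum_range_succ hYm n).measure_inter_preimage_eq_mul {j} {l}
      (measurableSet_singleton _) (measurableSet_singleton _)
    simp only [Measure.real, this, ENNReal.toReal_mul]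
  have hset : ∀ n k, {ω | ∑ i ∈ Finset.range n, Y i ω = k} =
      (∑ i ∈ Finset.range n, Y i) ⁻¹' {k} := by
    intro n k; ext ω; simp
  have hY01 : ∀ i ω, Y i ω = 0 ∨ Y i ω = 1 := by
    intro i ω
    by_cases h : X i ω ∈ B <;> simp [hY, h]
  change μ.real {ω | ∑ i ∈ Finset.range n, Y i ω = k} = _
  rw [hset]
  induction n generalizing k with
  | zero =>
    cases k with
    | zero => simp [Set.preimage]
    | succ k => simp [Set.preimage]
  | succ n ih =>
    cases k with
    | zero =>
      have : (∑ i ∈ Finset.range (n + 1), Y i) ⁻¹' {0} =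
          (∑ i ∈ Finset.range n, Y i) ⁻¹' {0} ∩ Y n ⁻¹' {0} := by
        ext ω
        simp [Finset.sum_range_succ]
      rw [this, hind, ih, h0]
      simp [pow_succ]
    | succ k =>
      have : (∑ i ∈ Finset.range (n + 1), Y i) ⁻¹' {k + 1} =
          ((∑ i ∈ Finset.range n, Y i) ⁻¹' {k} ∩ Y n ⁻¹' {1}) ∪
          ((∑ i ∈ Finset.range n, Y i) ⁻¹' {k + 1} ∩ Y n ⁻¹' {0}) := by
        ext ω
        rcases hY01 n ω with h | h <;> simp [Finset.sum_range_succ, h]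
      rw [this, measureReal_union _ ((hS n (measurableSet_singleton _)).inter
        (hYm n (measurableSet_singleton _))), hind, hind, ih, ih, h0, h1, Nat.choose_succ_succ,
        Nat.add_sub_add_right]
      · rcases Nat.lt_or_ge n (k + 1) with h | h
        · rw [Nat.choose_eq_zero_of_lt h]; push_cast; ring
        · obtain ⟨m, rfl⟩ := Nat.exists_eq_add_of_le h
          rw [show k + 1 + m - k = m + 1 by omega, show k + 1 + m - (k + 1) = m by omega]
          push_cast; ring
      · rw [Set.disjoint_left]
        rintro ω ⟨-, h⟩ ⟨-, h'⟩
        simp only [Set.mem_preimage, Set.mem_singleton_iff] at h h'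
        omega

/-- Thinning: a binomial number with a Poisson number of trials has a Poisson distribution. -/
theorem hasSum_poisson_mul_binomial (Λ p : ℝ) (k : ℕ) :
    HasSum (fun n : ℕ => Real.exp (-Λ) * Λ ^ n / n.factorial *
        (n.choose k * p ^ k * (1 - p) ^ (n - k)))
      (Real.exp (-(Λ * p)) * (Λ * p) ^ k / k.factorial) := by
  rw [← Function.Injective.hasSum_iff (add_left_injective k)]
  · have h := (NormedSpace.expSeries_div_hasSum_exp (Λ * (1 - p))).mul_left
      (Real.exp (-Λ) * (Λ * p) ^ k / k.factorial)
    rw [← Real.exp_eq_exp_ℝ] at h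
    convert! h using 1
    · ext m
      simp only [Function.comp_apply, Nat.add_sub_cancel]
      have hc : ((m + k).choose k : ℝ) * m.factorial * k.factorial = (m + k).factorial := by
        have := Nat.add_choose_mul_factorial_mul_factorial m k
        exact_mod_cast this
      have h1 : (m.factorial : ℝ) ≠ 0 := by positivity
      have h2 : (k.factorial : ℝ) ≠ 0 := by positivity
      have h3 : ((m + k).factorial : ℝ) ≠ 0 := by positivity
      rw [mul_pow, mul_pow, pow_add]
      field_simp
      rw [← hc]; ring
    · rw [show -(Λ * p) = -Λ + Λ * (1 - p) by ring, Real.exp_add]; ring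
  · intro n hn
    have : n < k := by
      by_contra! h
      exact hn ⟨n - k, Nat.sub_add_cancel h⟩
    simp [Nat.choose_eq_zero_of_lt this]

theorem measureReal_sum_indicator_eq_of_poisson {P : Measure E} {μ : Measure Ω}
    [IsProbabilityMeasure μ]
    {X : ℕ → Ω → E} (hXm : ∀ i, Measurable (X i)) (hXlaw : ∀ i, μ.map (X i) = P)
    (hXind : iIndepFun X μ) {K : Ω → ℕ} (hK : Measurable K) {Λ : ℝ≥0}
    (hKlaw : μ.map K = poissonMeasure Λ) (hKX : IndepFun K (fun ω i => X i ω) μ)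
    {B : Set E} (hB : MeasurableSet B) (k : ℕ) :
    μ.real {ω | ∑ i ∈ Finset.range (K ω), B.indicator (fun _ => (1 : ℕ)) (X i ω) = k} =
      Real.exp (-(Λ * P.real B)) * (Λ * P.real B) ^ k / k.factorial := by
  set S : ℕ → Set Ω := fun n =>
    {ω | ∑ i ∈ Finset.range n, B.indicator (fun _ => (1 : ℕ)) (X i ω) = k} with hS
  have hXpi : Measurable fun ω i => X i ω := measurable_pi_lambda _ hXm
  have hSeq : ∀ n, S n = (fun ω i => X i ω) ⁻¹'
      {s | ∑ i ∈ Finset.range n, B.indicator (fun _ => (1 : ℕ)) (s i) = k} := fun n => rfl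
  have hTm : ∀ n, MeasurableSet {s : ℕ → E |
      ∑ i ∈ Finset.range n, B.indicator (fun _ => (1 : ℕ)) (s i) = k} := fun n =>
    measurable_sum_indicator hB n (measurableSet_singleton k)
  have hunion : {ω | ∑ i ∈ Finset.range (K ω), B.indicator (fun _ => (1 : ℕ)) (X i ω) = k} =
      ⋃ n, K ⁻¹' {n} ∩ S n := by
    ext ω; simp [hS]
  have hsum : HasSum (fun n => μ.real (K ⁻¹' {n} ∩ S n)) (μ.real (⋃ n, K ⁻¹' {n} ∩ S n)) := by
    have := hasSum_integral_iUnion (μ := μ) (s := fun n => K ⁻¹' {n} ∩ S n) (f := fun _ => (1 : ℝ))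
      (fun n => (hK (measurableSet_singleton n)).inter (hXpi (hTm n)))
      (fun m n hmn => Set.disjoint_left.2 fun ω h h' => hmn (h.1.symm.trans h'.1))
      (integrable_const _).integrableOn
    simpa using this
  rw [hunion]
  refine hsum.unique ?_
  convert! hasSum_poisson_mul_binomial (Λ : ℝ) (P.real B) k using 2 with n
  rw [hSeq, ← measureReal_sum_indicator_eq hXm hXlaw hXind hB n k,
    ← poissonMeasure_real_singleton, ← hKlaw, map_measureReal_apply hK (measurableSet_singleton n)]
  have := hKX.measure_inter_preimage_eq_mul {n} _ (measurableSet_singleton _) (hTm n)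
  simp only [Measure.real, this, ENNReal.toReal_mul]
  rfl

end Counting

/-! ### Occupancy probabilities and the counting measure -/

theorem ballCount_eq_sum_indicator_ball {E : Type*} [MetricSpace E]
    (s : ℕ → E) (δ : ℝ) (n : ℕ) (x : E) :
    ballCount s δ n x =
      ∑ i ∈ Finset.range n, (Metric.ball x δ).indicator (fun _ => (1 : ℕ)) (s i) := by
  refine Finset.sum_congr rfl fun i _ => ?_
  by_cases h : dist x (s i) < δ <;> simp [Set.indicator, Metric.mem_ball, h, dist_comm (s i)]

section MetricSpace

variable {E : Type*} [MetricSpace E] [MeasurableSpace E]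

/-- Almost every point is the centre of a ball of positive mass: the exceptional points of a
separable set are covered by countably many null balls of radius `δ / 2`. -/
theorem ae_measure_ball_ne_zero {P : Measure E}
    (hsep : ∃ S : Set E, TopologicalSpace.IsSeparable S ∧ P Sᶜ = 0) {δ : ℝ} (hδ : 0 < δ) :
    ∀ᵐ x ∂P, P (Metric.ball x δ) ≠ 0 := by
  obtain ⟨S, ⟨C, hC, hSC⟩, hPS⟩ := hsep
  have hSae : ∀ᵐ x ∂P, x ∈ S := hPS
  have hnull : P (⋃ q ∈ {q ∈ C | P (Metric.ball q (δ / 2)) = 0}, Metric.ball q (δ / 2)) = 0 :=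
    (measure_biUnion_null_iff (hC.mono (Set.sep_subset _ _))).2 fun q hq => hq.2
  filter_upwards [hSae, measure_eq_zero_iff_ae_notMem.1 hnull] with x hx hxn h0
  obtain ⟨q, hqC, hq⟩ := Metric.mem_closure_iff.1 (hSC hx) (δ / 2) (by linarith)
  refine hxn (Set.mem_biUnion (x := q) ⟨hqC, measure_mono_null ?_ h0⟩ hq)
  refine Metric.ball_subset_ball' ?_
  rw [dist_comm] at hq
  linarith

variable [BorelSpace E]

/-- On a space that is not second countable `{(y, x) | dist x y < δ}` need not be measurable for the
product `σ`-algebra. Restricting `x` to a separable set, it coincides with the countable union of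
the rectangles `B_{q,δ-η} × B_{q,η}`, with `q` in a countable dense set and `η` rational. -/
theorem exists_measurableSet_prod_ball {S : Set E} (hS : TopologicalSpace.IsSeparable S) (δ : ℝ) :
    ∃ D : Set (E × E), MeasurableSet D ∧
      ∀ x ∈ S, ∀ y, (y, x) ∈ D ↔ x ∈ Metric.ball y δ := by
  obtain ⟨C, hC, hSC⟩ := hS
  refine ⟨⋃ q ∈ C, ⋃ η : ℚ, Metric.ball q (δ - η) ×ˢ Metric.ball q η, ?_, ?_⟩
  · exact MeasurableSet.biUnion hC fun q _ => MeasurableSet.iUnion fun η =>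
      measurableSet_ball.prod measurableSet_ball
  · intro x hx y
    simp only [Set.mem_iUnion, Set.mem_prod, Metric.mem_ball, exists_prop]
    constructor
    · rintro ⟨q, -, η, h1, h2⟩
      have := dist_triangle x q y
      rw [dist_comm q y] at this
      linarith
    · intro hxy
      have hpos : 0 < (δ - dist x y) / 2 := by linarith
      obtain ⟨η, hη0, hη⟩ := exists_rat_btwn hpos
      obtain ⟨q, hqC, hq⟩ := Metric.mem_closure_iff.1 (hSC hx) η hη0
      refine ⟨q, hqC, η, ?_, hq⟩
      have := dist_triangle y x q
      rw [dist_comm y x] at this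
      linarith

/-- The mean occupancy probability of a sample of Poisson size `K`: by Fubini's theorem it is the
integral over `x` of the probability that exactly `r` sample points fall into the ball around
`x`. -/
theorem integrable_occupancyProb_and_integral_eq {P : Measure E} [IsProbabilityMeasure P]
    (hsep : ∃ S : Set E, TopologicalSpace.IsSeparable S ∧ P Sᶜ = 0)
    {Ω : Type*} [MeasurableSpace Ω] {μ : Measure Ω} [IsProbabilityMeasure μ]
    {X : ℕ → Ω → E} (hXm : ∀ i, Measurable (X i)) (hXlaw : ∀ i, μ.map (X i) = P)
    (hXind : iIndepFun X μ) {K : Ω → ℕ} (hK : Measurable K) {Λ : ℝ≥0}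
    (hKlaw : μ.map K = poissonMeasure Λ) (hKX : IndepFun K (fun ω i => X i ω) μ)
    (δ : ℝ) (r : ℕ) :
    Integrable (fun ω => occupancyProb P δ (fun i => X i ω) (K ω) r) μ ∧
    ∫ ω, occupancyProb P δ (fun i => X i ω) (K ω) r ∂μ =
      ∫ x, Real.exp (-(Λ * P.real (Metric.ball x δ))) * (Λ * P.real (Metric.ball x δ)) ^ r /
        r.factorial ∂P := by
  obtain ⟨S, hS, hPS⟩ := hsep
  obtain ⟨D, hD, hDball⟩ := exists_measurableSet_prod_ball hS δ
  have hSae : ∀ᵐ x ∂P, x ∈ S := hPS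
  -- the event that exactly `r` balls cover `x`, rewritten so as to be jointly measurable
  set A : Set (Ω × E) :=
    {z | ∑ i ∈ Finset.range (K z.1), D.indicator (fun _ => (1 : ℕ)) (X i z.1, z.2) = r} with hA
  have hAm : MeasurableSet A := by
    have : A = ⋃ n, {z | K z.1 = n} ∩
        {z | ∑ i ∈ Finset.range n, D.indicator (fun _ => (1 : ℕ)) (X i z.1, z.2) = r} := by
      ext z; simp [hA]
    rw [this]
    refine MeasurableSet.iUnion fun n => ((hK.comp measurable_fst)
      (measurableSet_singleton n)).inter (measurableSet_eq_fun ?_ measurable_const)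
    refine Finset.measurable_sum _ fun i _ => (measurable_const.indicator hD).comp ?_
    exact ((hXm i).comp measurable_fst).prodMk measurable_snd
  have hcount : ∀ x ∈ S, ∀ ω, ballCount (fun i => X i ω) δ (K ω) x =
      ∑ i ∈ Finset.range (K ω), D.indicator (fun _ => (1 : ℕ)) (X i ω, x) := by
    intro x hx ω
    refine Finset.sum_congr rfl fun i _ => ?_
    by_cases h : x ∈ Metric.ball (X i ω) δ
    · rw [Set.indicator_of_mem h, Set.indicator_of_mem ((hDball x hx _).2 h)]
    · rw [Set.indicator_of_notMem h, Set.indicator_of_notMem (mt (hDball x hx _).1 h)]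
  have hocc : ∀ ω, occupancyProb P δ (fun i => X i ω) (K ω) r =
      ∫ x, A.indicator (fun _ => (1 : ℝ)) (ω, x) ∂P := by
    intro ω
    refine integral_congr_ae ?_
    filter_upwards [hSae] with x hx
    simp only [Set.indicator_apply, hA, Set.mem_ofPred_eq, hcount x hx ω]
  have hint : Integrable (A.indicator fun _ => (1 : ℝ)) (μ.prod P) :=
    (integrable_const _).indicator hAm
  simp_rw [hocc]
  refine ⟨hint.integral_prod_left, ?_⟩
  rw [integral_integral_swap (f := fun ω x => A.indicator (fun _ => (1 : ℝ)) (ω, x)) hint]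
  refine integral_congr_ae ?_
  filter_upwards [hSae] with x hx
  rw [← measureReal_sum_indicator_eq_of_poisson hXm hXlaw hXind hK hKlaw hKX
    (measurableSet_ball (x := x)) r]
  simp_rw [← ballCount_eq_sum_indicator_ball (fun i => X i _)]
  have hm : MeasurableSet ((fun ω => (ω, x)) ⁻¹' A) := hAm.preimage (by fun_prop)
  have := integral_indicator_one (μ := μ) hm
  have hset : {ω | ballCount (fun i => X i ω) δ (K ω) x = r} = (fun ω => (ω, x)) ⁻¹' A := by
    ext ω
    simp only [hA, Set.mem_ofPred_eq, Set.mem_preimage, hcount x hx ω]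
  rw [hset, ← this]
  rfl

theorem measure_Ici_ballCountingMeasure_ne_top (P : Measure E) [IsProbabilityMeasure P] (δ : ℝ)
    {ε : ℝ} (hε : 0 < ε) : ballCountingMeasure P δ (Set.Ici ε) ≠ ∞ := by
  rw [← lintegral_indicator_one measurableSet_Ici,
    lintegral_ballCountingMeasure P δ _ (measurable_one.indicator measurableSet_Ici)]
  have hle : ∀ x, (P (Metric.ball x δ))⁻¹ * (Set.Ici ε).indicator 1 (P.real (Metric.ball x δ)) ≤
      (ENNReal.ofReal ε)⁻¹ := by
    intro x
    by_cases h : P.real (Metric.ball x δ) ∈ Set.Ici ε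
    · rw [Set.indicator_of_mem h, Pi.one_apply, mul_one, ENNReal.inv_le_inv]
      exact ENNReal.ofReal_le_of_le_toReal h
    · simp [Set.indicator_of_notMem h]
  refine ne_top_of_le_ne_top ?_ (lintegral_mono hle)
  simpa using hε

theorem ae_ballCountingMeasure_nonneg (P : Measure E) [IsProbabilityMeasure P] (δ : ℝ) :
    ∀ᵐ u ∂ballCountingMeasure P δ, 0 ≤ u := by
  have hr : Measurable fun x => P.real (Metric.ball x δ) :=
    (measurable_measure_ball P δ).ennreal_toReal
  exact (ae_map_iff hr.aemeasurable measurableSet_Ici).2 (ae_of_all _ fun x => measureReal_nonneg)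

theorem ballCountingFun_eq_measureReal_Ici (P : Measure E) [IsProbabilityMeasure P] (δ ε : ℝ) :
    ballCountingFun P δ ε = (ballCountingMeasure P δ).real (Set.Ici ε) := by
  have hr : Measurable fun x => P.real (Metric.ball x δ) :=
    (measurable_measure_ball P δ).ennreal_toReal
  have hle : ∀ᵐ u ∂ballCountingMeasure P δ, u ≤ 1 :=
    (ae_map_iff hr.aemeasurable measurableSet_Iic).2 (ae_of_all _ fun x => measureReal_le_one)
  refine measureReal_congr ?_
  filter_upwards [hle] with u hu
  exact propext ⟨fun h => h.1, fun h => ⟨h, hu⟩⟩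

/-- Under `u * ν(du)` the density `1 / P (B_{x,δ})` cancels, almost every ball having positive
mass. -/
theorem integral_ballCountingMeasure_mul {P : Measure E} [IsProbabilityMeasure P]
    (hsep : ∃ S : Set E, TopologicalSpace.IsSeparable S ∧ P Sᶜ = 0) {δ : ℝ} (hδ : 0 < δ)
    {f : ℝ → ℝ} (hf : Measurable f) (hf0 : ∀ u, 0 ≤ u → 0 ≤ f u) :
    ∫ u, u * f u ∂ballCountingMeasure P δ = ∫ x, f (P.real (Metric.ball x δ)) ∂P := by
  have hr : Measurable fun x => P.real (Metric.ball x δ) :=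
    (measurable_measure_ball P δ).ennreal_toReal
  rw [integral_eq_lintegral_of_nonneg_ae _ (by fun_prop),
    integral_eq_lintegral_of_nonneg_ae (ae_of_all _ fun x => hf0 _ measureReal_nonneg)
      (hf.comp hr).aestronglyMeasurable,
    lintegral_ballCountingMeasure P δ _ (by fun_prop)]
  · congr 1
    refine lintegral_congr_ae ?_
    filter_upwards [ae_measure_ball_ne_zero hsep hδ] with x hx
    rw [ENNReal.ofReal_mul measureReal_nonneg, ofReal_measureReal, ← mul_assoc,
      ENNReal.inv_mul_cancel hx (measure_ne_top _ _), one_mul]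
  · filter_upwards [ae_ballCountingMeasure_nonneg P δ] with u hu
    exact mul_nonneg hu (hf0 u hu)

theorem integrable_id_ballCountingMeasure (P : Measure E) [IsProbabilityMeasure P] (δ : ℝ) :
    Integrable (fun u => u) (ballCountingMeasure P δ) := by
  refine ⟨by fun_prop, ?_⟩
  rw [hasFiniteIntegral_iff_ofReal (ae_ballCountingMeasure_nonneg P δ),
    lintegral_ballCountingMeasure P δ _ (by fun_prop)]
  have hle : ∀ x, (P (Metric.ball x δ))⁻¹ * ENNReal.ofReal (P.real (Metric.ball x δ)) ≤ 1 := by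
    intro x
    rw [ofReal_measureReal]
    exact ENNReal.inv_mul_le_one _
  exact (lintegral_mono hle).trans_lt (by simp)

end MetricSpace

/-- The mean-`Λ_t` Poisson law of `N t` is that of the increment over `[0, t]`, as `N 0 = 0`. -/
theorem IsPoissonProcess.map_eq_poissonMeasure {Ω : Type*} [MeasurableSpace Ω] {N : ℝ≥0 → Ω → ℕ}
    {lam : ℝ → ℝ} {μ : Measure Ω} (hN : IsPoissonProcess N lam μ) (t : ℝ≥0) :
    μ.map (N t) = poissonMeasure (cumulativeIntensity lam t).toNNReal := by
  rw [cumulativeIntensity, ← NNReal.coe_zero, ← hN.increment_law 0 t zero_le]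
  refine Measure.map_congr ?_
  filter_upwards [hN.start] with ω hω
  simp [hω]

/-! ### Mean occupancy probabilities -/

section Asymptotics

variable {E : Type*} [MetricSpace E] [MeasurableSpace E] [BorelSpace E]

theorem measureReal_Ici_ballCountingMeasure_eq {P : Measure E} [IsProbabilityMeasure P]
    {δ α : ℝ} {ℓ : ℝ → ℝ}
    (hν : ∀ ε : ℝ, 0 < ε → ε ≤ 1 → ballCountingFun P δ ε = ε ^ (-α) * ℓ (1 / ε))
    {x : ℝ} (hx : 1 ≤ x) :
    (ballCountingMeasure P δ).real (Set.Ici (1 / x)) = x ^ α * ℓ x := by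
  have hx0 : 0 < x := by linarith
  rw [← ballCountingFun_eq_measureReal_Ici, hν _ (by positivity) ((div_le_one hx0).2 hx),
    one_div_one_div, one_div, Real.inv_rpow hx0.le, Real.rpow_neg hx0.le, inv_inv]

theorem regularlyVaryingAtTop_measureReal_Ici {P : Measure E} [IsProbabilityMeasure P]
    {δ α : ℝ} {ℓ : ℝ → ℝ} (hℓ : SlowlyVaryingAtTop ℓ)
    (hν : ∀ ε : ℝ, 0 < ε → ε ≤ 1 → ballCountingFun P δ ε = ε ^ (-α) * ℓ (1 / ε)) :
    RegularlyVaryingAtTop (fun x => (ballCountingMeasure P δ).real (Set.Ici (1 / x))) α := by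
  intro c hc
  have h := (hℓ c hc).const_mul (c ^ α)
  rw [Real.rpow_zero, mul_one] at h
  refine h.congr' ?_
  filter_upwards [eventually_ge_atTop 1, eventually_ge_atTop c⁻¹] with x hx hxc
  have hx0 : 0 < x := by linarith
  have hcx : 1 ≤ c * x := by
    rwa [inv_le_iff_one_le_mul₀' hc] at hxc
  have : x ^ α ≠ 0 := (Real.rpow_pos_of_pos hx0 α).ne'
  rw [measureReal_Ici_ballCountingMeasure_eq hν hx, measureReal_Ici_ballCountingMeasure_eq hν hcx,
    Real.mul_rpow hc.le hx0.le, mul_right_comm, mul_comm (x ^ α) (ℓ x), mul_div_mul_right _ _ this,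
    mul_div_assoc]

/-- The mean occupancy probability, relative to `x ^ (α - 1) * ℓ x`, in the form to which the Abelian
theorem applies with exponent `r + 1`. -/
theorem integral_poisson_ball_div_eq {P : Measure E} [IsProbabilityMeasure P]
    (hsep : ∃ S : Set E, TopologicalSpace.IsSeparable S ∧ P Sᶜ = 0) {δ : ℝ} (hδ : 0 < δ)
    {α : ℝ} {ℓ : ℝ → ℝ}
    (hν : ∀ ε : ℝ, 0 < ε → ε ≤ 1 → ballCountingFun P δ ε = ε ^ (-α) * ℓ (1 / ε))
    (r : ℕ) {x : ℝ} (hx : 1 ≤ x) :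
    (∫ y, Real.exp (-(x * P.real (Metric.ball y δ))) * (x * P.real (Metric.ball y δ)) ^ r /
        r.factorial ∂P) / (x ^ (α - 1) * ℓ x) =
      (∫ u, (x * u) ^ (r + 1) * Real.exp (-(x * u)) ∂ballCountingMeasure P δ) /
        (ballCountingMeasure P δ).real (Set.Ici (1 / x)) / r.factorial := by
  have hx0 : 0 < x := by linarith
  rw [← integral_ballCountingMeasure_mul hsep hδ
    (f := fun u => Real.exp (-(x * u)) * (x * u) ^ r / r.factorial) (by fun_prop)
    (fun u hu => by positivity), measureReal_Ici_ballCountingMeasure_eq hν hx]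
  have : ∀ u : ℝ, u * (Real.exp (-(x * u)) * (x * u) ^ r / r.factorial) =
      (x⁻¹ * (r.factorial : ℝ)⁻¹) * ((x * u) ^ (r + 1) * Real.exp (-(x * u))) := by
    intro u
    field_simp
    ring
  simp_rw [this]
  rw [integral_const_mul, Real.rpow_sub_one hx0.ne']
  field_simp

end Asymptotics

end Occupancy

theorem mainTheorem8
    {E : Type*} [MetricSpace E] [MeasurableSpace E] [BorelSpace E]
    (P : Measure E) [IsProbabilityMeasure P]
    (hsep : ∃ S : Set E, TopologicalSpace.IsSeparable S ∧ P Sᶜ = 0)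
    {Ω : Type*} [MeasurableSpace Ω] (μ : Measure Ω) [IsProbabilityMeasure μ]
    -- the i.i.d. observations
    (X : ℕ → Ω → E) (hXm : ∀ i, Measurable (X i)) (hXlaw : ∀ i, μ.map (X i) = P)
    (hXind : iIndepFun X μ)
    -- the Poisson process, independent of the observations
    (lam : ℝ → ℝ) (N : ℝ≥0 → Ω → ℕ) (hN : Occupancy.IsPoissonProcess N lam μ)
    (hNX : IndepFun (fun ω t => N t ω) (fun ω i => X i ω) μ)
    (hLam : Tendsto (Occupancy.cumulativeIntensity lam) atTop atTop)
    (δ : ℝ) (hδ : 0 < δ) (α : ℝ) (hα0 : 0 ≤ α) (hα1 : α ≤ 1)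
    (ℓ : ℝ → ℝ) (hℓ : Occupancy.SlowlyVaryingAtTop ℓ)
    (hν : ∀ ε : ℝ, 0 < ε → ε ≤ 1 →
      Occupancy.ballCountingFun P δ ε = ε ^ (-α) * ℓ (1 / ε))
    (r : ℕ) :
    -- `M_r^{(δ)}(t)` is an integrable random variable
    (∀ t, Integrable (fun ω => Occupancy.occupancyProb P δ (fun i => X i ω) (N t ω) r) μ) ∧
    -- the constant is positive and finite: asymptotic equivalence
    (0 < α → (α < 1 ∨ 1 ≤ r) →
      Tendsto (fun t =>
          (∫ ω, Occupancy.occupancyProb P δ (fun i => X i ω) (N t ω) r ∂μ) /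
            (α * Real.Gamma (1 + r - α) / (r.factorial : ℝ) *
              (Occupancy.cumulativeIntensity lam t) ^ (α - 1) *
              ℓ (Occupancy.cumulativeIntensity lam t)))
        atTop (𝓝 1)) ∧
    -- the constant is zero
    (α = 0 →
      Tendsto (fun t =>
          (∫ ω, Occupancy.occupancyProb P δ (fun i => X i ω) (N t ω) r ∂μ) /
            ((Occupancy.cumulativeIntensity lam t) ^ (α - 1) *
              ℓ (Occupancy.cumulativeIntensity lam t)))
        atTop (𝓝 0)) ∧
    -- the constant is `Γ(0) = +∞`
    (α = 1 → r = 0 →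
      Tendsto (fun t =>
          (∫ ω, Occupancy.occupancyProb P δ (fun i => X i ω) (N t ω) r ∂μ) /
            ((Occupancy.cumulativeIntensity lam t) ^ (α - 1) *
              ℓ (Occupancy.cumulativeIntensity lam t)))
        atTop atTop) := by
  set Λ := Occupancy.cumulativeIntensity lam
  set ν := Occupancy.ballCountingMeasure P δ
  have hmean := fun t => Occupancy.integrable_occupancyProb_and_integral_eq hsep hXm hXlaw hXind
    (hN.measurable t) (hN.map_eq_poissonMeasure t)
    (hNX.comp (measurable_pi_apply t) measurable_id) δ r
  have hratio : (fun x => (∫ u, (x * u) ^ (r + 1) * Real.exp (-(x * u)) ∂ν) /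
        ν.real (Set.Ici (1 / x)) / r.factorial) ∘ Λ =ᶠ[atTop] fun t =>
      (∫ ω, Occupancy.occupancyProb P δ (fun i => X i ω) (N t ω) r ∂μ) /
        (Λ t ^ (α - 1) * ℓ (Λ t)) := by
    filter_upwards [hLam.eventually_ge_atTop 1] with t ht
    rw [(hmean t).2, Real.coe_toNNReal _ (by linarith : (0 : ℝ) ≤ Λ t),
      Occupancy.integral_poisson_ball_div_eq hsep hδ hν r ht]
    rfl
  have hν0 := Occupancy.ae_ballCountingMeasure_nonneg P δ
  have hνfin := fun ε (hε : 0 < ε) =>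
    Occupancy.measure_Ici_ballCountingMeasure_ne_top P δ hε
  have hRV := Occupancy.regularlyVaryingAtTop_measureReal_Ici hℓ hν
  -- one limit serves all cases but `α = 1`, `r = 0`, including `α = 0`, where it vanishes
  have hlim : (α < 1 ∨ 1 ≤ r) → Tendsto (fun t =>
      (∫ ω, Occupancy.occupancyProb P δ (fun i => X i ω) (N t ω) r ∂μ) /
        (Λ t ^ (α - 1) * ℓ (Λ t))) atTop
      (𝓝 (α * Real.Gamma (1 + r - α) / (r.factorial : ℝ))) := by
    intro h
    have hαr : α < (r : ℝ) + 1 := by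
      rcases h with h | h
      · have : (0 : ℝ) ≤ r := r.cast_nonneg
        linarith
      · have : (1 : ℝ) ≤ r := by exact_mod_cast h
        linarith
    have := (Occupancy.tendsto_integral_rpow_mul_exp hν0 hνfin hα0 hαr hRV).2.div_const
      (r.factorial : ℝ)
    rw [add_comm (r : ℝ) 1] at this
    refine Tendsto.congr' hratio ((this.congr fun x => ?_).comp hLam)
    congr! 5 with u
    rw [add_comm, ← Nat.cast_add_one, Real.rpow_natCast]
  refine ⟨fun t => (hmean t).1, fun hα h => ?_, fun hα => ?_, fun hα hr => ?_⟩
  · have hC : α * Real.Gamma (1 + r - α) / (r.factorial : ℝ) ≠ 0 := by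
      have : 0 < Real.Gamma (1 + r - α) := by
        refine Real.Gamma_pos_of_pos ?_
        rcases h with h | h
        · have : (0 : ℝ) ≤ r := r.cast_nonneg
          linarith
        · have : (1 : ℝ) ≤ r := by exact_mod_cast h
          linarith
      positivity
    have := (hlim h).div_const (α * Real.Gamma (1 + r - α) / (r.factorial : ℝ))
    rw [div_self hC] at this
    refine this.congr fun t => ?_
    rw [div_div, mul_comm (_ * _) (_ / _), mul_assoc]
  · have := hlim (Or.inl (by linarith))
    simpa [hα] using this
  · subst hα hr
    refine Tendsto.congr' hratio (Tendsto.comp ?_ hLam)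
    have := Occupancy.tendsto_integral_mul_exp_atTop hν0 hνfin
      (Occupancy.integrable_id_ballCountingMeasure P δ) hRV
    simpa using this
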